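/- Let $S_n$ be the set of permutations of $\{1,\dots,n\}$. An occurrence of the pattern $321$ in $\pi\in S_n$ is a triple of positions $i_1<i_2<i_3$ with $\pi(i_1)>\pi(i_2)>\pi(i_3)$, and $S_n(321;1)$ is the set of $\pi\in S_n$ with exactly one occurrence of $321$. A Dumont permutation of the fourth kind of length $2n$ is a permutation $\pi\in S_{2n}$ such that, for all $1\le i\le 2n$, if $\pi(i)<i$ then both $i$ and $\pi(i)$ are even; let $\mathfrak{D}^4_{2n}(321;1)$ be the set of those with exactly one occurrence of $321$. Let $C_n=\frac{1}{n+1}\binom{2n}{n}$ be the Catalan numbers and $C(z)=\sum_{n\ge 0}C_nz^n$; a binomial coefficient $\binom{a}{k}$ with $k<0$ is $0$. Theorem. For all $n\ge 1$, \[ \begin{aligned} |\mathfrak{D}^4_{2n}(321;1)| &= |S_n(321;1)|+|S_{n+1}(321;1)|\\ &=\frac{3}{n}\binom{2n}{n-3}+\frac{3}{n+1}\binom{2n+2}{n-2}\\ &= C_{n+3}-3C_{n+2}-C_{n+1}+3C_n . \end{aligned} \] Moreover, as formal power series, \[ \sum_{n\ge 0}|\mathfrak{D}^4_{2n}(321;1)|\,z^n=(z^2+z^3)\,C(z)^6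 . \] -/

import Mathlib

/-- The occurrences of the pattern `q` in the permutation `p`: increasing choices of positions
`f 0 < f 1 < ⋯` such that the entries of `p` at these positions are in the same relative order
as the entries of `q`. -/
def patternOccurrences {k n : ℕ} (q : Equiv.Perm (Fin k)) (p : Equiv.Perm (Fin n)) :
    Set (Fin k ↪o Fin n) :=
  {f | ∀ a b : Fin k, p (f a) < p (f b) ↔ q a < q b}

/-- `p` contains exactly `m` occurrences of the pattern `q`. -/
def HasOccurrences {k n : ℕ} (q : Equiv.Perm (Fin k)) (m : ℕ) (p : Equiv.Perm (Fin n)) : Prop :=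
  (patternOccurrences q p).ncard = m

/-- The pattern `321`, that is, the decreasing permutation of three letters
(on the letters `0, 1, 2` of `Fin 3`). -/
def pattern321 : Equiv.Perm (Fin 3) := Fin.revPerm

/-- Dumont permutations of the fourth kind, of length `2n`: every deficiency is an even value at an
even position. Positions and values are `1, …, 2n`, so that the element `i` of `Fin (2 * n)`
stands for the number `i + 1`. -/
def IsDumont4 (n : ℕ) (p : Equiv.Perm (Fin (2 * n))) : Prop :=
  ∀ i : Fin (2 * n), p i < i → Even ((i : ℕ) + 1) ∧ Even ((p i : ℕ) + 1)

/-- `S_n(q; m)`: the permutations of length `n` with exactly `m` occurrences of `q`. -/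
def permsWithOccurrences (n : ℕ) {k : ℕ} (q : Equiv.Perm (Fin k)) (m : ℕ) :
    Set (Equiv.Perm (Fin n)) :=
  {p | HasOccurrences q m p}

/-- `𝔇⁴_{2n}(q; m)`: the Dumont permutations of the fourth kind of length `2n` with exactly `m`
occurrences of `q`. -/
def dumont4WithOccurrences (n : ℕ) {k : ℕ} (q : Equiv.Perm (Fin k)) (m : ℕ) :
    Set (Equiv.Perm (Fin (2 * n))) :=
  {p | IsDumont4 n p ∧ HasOccurrences q m p}

/-- The binomial coefficient with an integer lower index, zero when that index is negative. -/
def intChoose (a : ℕ) (k : ℤ) : ℕ := if 0 ≤ k then a.choose k.toNat else 0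

/-! If the only 321 sits at positions i<j<k, then i is the only larger entry before j and k the only
smaller entry after it, which forces π(j)=j. As many entries cross each gap upwards as downwards
(`card_crossing`), so an inversion among the deficiencies, or among the other positions apart from
j, extends to a 321 that contradicts uniqueness. Thus one occurrence amounts to a center
(`HasCenter`).

Such a permutation is encoded by a path: up at values of deficiencies, down at their positions, mark
at the center. The height counts the deficiencies crossing a gap, hence is 1 at the mark.
Monotonicity on each class recovers the permutation, and every marked path arises
(`IsMarkedPath.exists_hasCenter`).

The Dumont condition makes every letter at an odd position flat or marked. Deleting these flat
letters leaves a path of length n if the mark is at an even position, and of length n+1 otherwise,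
where the mark stays beside its partner. Conversely, in a path of length n+1 the mark is never last,
since paths end at height 0. Hence the first identity (`evenPathCount_marked`).

The mark splits a path from 0 to 0 into two unmarked arms, between heights 0 and 1, each with series
XC^3. Marked paths thus have series X^3C^6, and C=1+XC^2 turns this into the Catalan and binomial
forms. -/

/-! ### Marked paths and their first-letter recurrences -/

/-- A letter of a marked path: `none` is the mark; in `some (v, p)` the flag `v` is a step up and
the flag `p` a step down. -/
abbrev PathLetter := Option (Bool × Bool)

/-- The letter contains a step up. -/
def PathLetter.opens : PathLetter → Bool
  | none => false
  | some a => a.1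

/-- The letter contains a step down. -/
def PathLetter.closes : PathLetter → Bool
  | none => false
  | some a => a.2

/-- The total change of height under a letter. -/
def PathLetter.rise (a : PathLetter) : ℤ :=
  (if a.opens then 1 else 0) - if a.closes then 1 else 0

/-- One for the mark, zero for the other letters. -/
def PathLetter.mark (a : PathLetter) : ℤ := if a = none then 1 else 0

/-- The height reached by the word `w` after its first `m` letters. -/
def pathHeight {N : ℕ} (w : Fin N → PathLetter) (m : ℕ) : ℤ :=
  ∑ i : Fin N, if i.1 < m then (w i).rise else 0

/-- The word `w` is a path from height `h` to height `0` that never goes below `0`, steps down only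
at positive height, and has exactly `x` marks, all of them at height `1`. -/
structure IsMarkedPath {N : ℕ} (h x : ℤ) (w : Fin N → PathLetter) : Prop where
  nonneg : ∀ m : ℕ, 0 ≤ h + pathHeight w m
  closes : ∀ i, (w i).closes = true → 1 ≤ h + pathHeight w i
  mark : ∀ i, w i = none → h + pathHeight w i = 1
  final : h + pathHeight w N = 0
  marks : ∑ i, (w i).mark = x

/-- All letters at odd positions (counted from one) are flat steps or marks. -/
def IsEvenWord {N : ℕ} (w : Fin N → PathLetter) : Prop :=
  ∀ i : Fin N, Even i.1 → w i = none ∨ w i = some (false, false)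

theorem pathHeight_zero {N : ℕ} (w : Fin N → PathLetter) : pathHeight w 0 = 0 := by
  simp [pathHeight]

theorem pathHeight_cons_succ {N : ℕ} (a : PathLetter) (w : Fin N → PathLetter) (m : ℕ) :
    pathHeight (Fin.cons a w : Fin (N + 1) → PathLetter) (m + 1) = a.rise + pathHeight w m := by
  simp [pathHeight, Fin.sum_univ_succ]

theorem isMarkedPath_cons {N : ℕ} (h x : ℤ) (a : PathLetter) (w : Fin N → PathLetter) :
    IsMarkedPath h x (Fin.cons a w : Fin (N + 1) → PathLetter) ↔
      (0 ≤ h ∧ (a.closes = true → 1 ≤ h) ∧ (a = none → h = 1)) ∧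
        IsMarkedPath (h + a.rise) (x - a.mark) w := by
  constructor
  · intro H
    refine ⟨⟨?_, fun ha => ?_, fun ha => ?_⟩, fun m => ?_, fun i hi => ?_, fun i hi => ?_, ?_, ?_⟩
    · simpa [pathHeight_zero] using H.nonneg 0
    · simpa [pathHeight_zero] using H.closes 0 ha
    · simpa [pathHeight_zero] using H.mark 0 ha
    · have := H.nonneg (m + 1)
      rwa [pathHeight_cons_succ, ← add_assoc] at this
    · have := H.closes i.succ (by simpa using hi)
      rwa [Fin.val_succ, pathHeight_cons_succ, ← add_assoc] at this
    · have := H.mark i.succ (by simpa using hi)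
      rwa [Fin.val_succ, pathHeight_cons_succ, ← add_assoc] at this
    · have := H.final
      rwa [pathHeight_cons_succ, ← add_assoc] at this
    · have := H.marks
      simp only [Fin.sum_univ_succ, Fin.cons_zero, Fin.cons_succ] at this
      linarith
  · rintro ⟨⟨h0, hc, hm⟩, H⟩
    refine ⟨fun m => ?_, fun i => ?_, fun i => ?_, ?_, ?_⟩
    · rcases m with _ | m
      · simpa [pathHeight_zero] using h0
      · rw [pathHeight_cons_succ, ← add_assoc]
        exact H.nonneg m
    · refine Fin.cases (fun hi => ?_) (fun i hi => ?_) i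
      · simpa [pathHeight_zero] using hc hi
      · rw [Fin.val_succ, pathHeight_cons_succ, ← add_assoc]
        exact H.closes i (by simpa using hi)
    · refine Fin.cases (fun hi => ?_) (fun i hi => ?_) i
      · simpa [pathHeight_zero] using hm hi
      · rw [Fin.val_succ, pathHeight_cons_succ, ← add_assoc]
        exact H.mark i (by simpa using hi)
    · rw [pathHeight_cons_succ, ← add_assoc]
      exact H.final
    · simp only [Fin.sum_univ_succ, Fin.cons_zero, Fin.cons_succ, H.marks]
      ring

theorem isEvenWord_cons_cons {N : ℕ} (a b : PathLetter) (w : Fin N → PathLetter) :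
    IsEvenWord (Fin.cons a (Fin.cons b w : Fin (N + 1) → PathLetter) : Fin (N + 2) → PathLetter) ↔
      (a = none ∨ a = some (false, false)) ∧ IsEvenWord w := by
  simp only [IsEvenWord, Fin.forall_fin_succ, Fin.cons_zero, Fin.cons_succ, Fin.val_succ,
    Fin.val_zero]
  simp [Nat.even_add_one]

/-- The number of marked paths. -/
noncomputable def pathCount (N : ℕ) (h x : ℤ) : ℕ :=
  Nat.card {w : Fin N → PathLetter // IsMarkedPath h x w}

/-- The number of marked paths whose letters at odd positions are flat steps or marks. -/
noncomputable def evenPathCount (n : ℕ) (h x : ℤ) : ℕ :=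
  Nat.card {w : Fin (2 * n) → PathLetter // IsMarkedPath h x w ∧ IsEvenWord w}

theorem card_words_succ {N : ℕ} (P : (Fin (N + 1) → PathLetter) → Prop) :
    Nat.card {w // P w} = ∑ a : PathLetter, Nat.card {w : Fin N → PathLetter // P (Fin.cons a w)} := by
  rw [← Nat.card_sigma]
  refine Nat.card_congr ?_
  refine ((Fin.consEquiv fun _ => PathLetter).subtypeEquiv (p := fun y => P (Fin.cons y.1 y.2))
    (q := P) fun y => Iff.rfl).symm.trans ?_
  exact
    { toFun := fun y => ⟨y.1.1, y.1.2, y.2⟩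
      invFun := fun y => ⟨(y.1, y.2.1), y.2.2⟩
      left_inv := fun _ => rfl
      right_inv := fun _ => rfl }

theorem sum_pathLetter (f : PathLetter → ℕ) :
    ∑ a, f a = f none + f (some (true, true)) + f (some (true, false)) + f (some (false, true)) +
      f (some (false, false)) := by
  rw [Fintype.sum_option, Fintype.sum_prod_type]
  simp only [Fintype.sum_bool]
  ring

theorem pathCount_zero (h x : ℤ) : pathCount 0 h x = if h = 0 ∧ x = 0 then 1 else 0 := by
  unfold pathCount
  have key : ∀ w : Fin 0 → PathLetter, IsMarkedPath h x w ↔ h = 0 ∧ x = 0 := by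
    intro w
    constructor
    · intro H
      exact ⟨by simpa [pathHeight] using H.final, by simpa [eq_comm] using H.marks⟩
    · rintro ⟨rfl, rfl⟩
      exact ⟨by simp [pathHeight], fun i => i.elim0, fun i => i.elim0, by simp [pathHeight],
        by simp⟩
  split_ifs with hx
  · obtain ⟨rfl, rfl⟩ := hx
    simp [key]
  · simp [key, hx]

theorem evenPathCount_zero (h x : ℤ) : evenPathCount 0 h x = if h = 0 ∧ x = 0 then 1 else 0 := by
  rw [← pathCount_zero]
  exact Nat.card_congr (Equiv.subtypeEquivRight fun w =>
    ⟨fun H => H.1, fun H => ⟨H, fun i => i.elim0⟩⟩)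

theorem card_subtype_const_and {α : Type*} (p : Prop) [Decidable p] (P : α → Prop) :
    Nat.card {a // p ∧ P a} = if p then Nat.card {a // P a} else 0 := by
  split_ifs with h <;> simp [h]

theorem pathCount_succ (N : ℕ) (h x : ℤ) :
    pathCount (N + 1) h x = ∑ a : PathLetter,
      if 0 ≤ h ∧ (a.closes = true → 1 ≤ h) ∧ (a = none → h = 1) then
        pathCount N (h + a.rise) (x - a.mark) else 0 := by
  unfold pathCount
  rw [card_words_succ]
  refine Finset.sum_congr rfl fun a _ => ?_
  rw [← card_subtype_const_and]
  exact Nat.card_congr (Equiv.subtypeEquivRight fun w => isMarkedPath_cons h x a w)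

theorem evenPathCount_succ (n : ℕ) (h x : ℤ) :
    evenPathCount (n + 1) h x = ∑ a : PathLetter, ∑ b : PathLetter,
      if (0 ≤ h ∧ (a.closes = true → 1 ≤ h) ∧ (a = none → h = 1)) ∧
        (0 ≤ h + a.rise ∧ (b.closes = true → 1 ≤ h + a.rise) ∧ (b = none → h + a.rise = 1)) ∧
          (a = none ∨ a = some (false, false)) then
        evenPathCount n (h + a.rise + b.rise) (x - a.mark - b.mark) else 0 := by
  unfold evenPathCount
  refine (card_words_succ (N := 2 * n + 1)
    fun w => IsMarkedPath h x w ∧ IsEvenWord w).trans ?_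
  refine Finset.sum_congr rfl fun a _ => ?_
  rw [card_words_succ]
  refine Finset.sum_congr rfl fun b _ => ?_
  rw [← card_subtype_const_and]
  refine Nat.card_congr (Equiv.subtypeEquivRight fun w => ?_)
  rw [isMarkedPath_cons, isMarkedPath_cons, isEvenWord_cons_cons]
  tauto

theorem pathCount_eq_zero_of_neg (N : ℕ) (h : ℤ) {x : ℤ} (hx : x < 0) : pathCount N h x = 0 := by
  unfold pathCount
  have : IsEmpty {w : Fin N → PathLetter // IsMarkedPath h x w} := by
    refine ⟨fun w => ?_⟩
    have h1 := w.2.marks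
    have h2 : 0 ≤ ∑ i, (w.1 i).mark :=
      Finset.sum_nonneg fun i _ => by unfold PathLetter.mark; split_ifs <;> simp
    omega
  simp

theorem evenPathCount_eq_zero_of_neg (n : ℕ) (h : ℤ) {x : ℤ} (hx : x < 0) :
    evenPathCount n h x = 0 := by
  unfold evenPathCount
  have : IsEmpty {w : Fin (2 * n) → PathLetter // IsMarkedPath h x w ∧ IsEvenWord w} := by
    refine ⟨fun w => ?_⟩
    have h1 := w.2.1.marks
    have h2 : 0 ≤ ∑ i, (w.1 i).mark :=
      Finset.sum_nonneg fun i _ => by unfold PathLetter.mark; split_ifs <;> simp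
    omega
  simp

theorem pathCount_succ_zero (N : ℕ) (x : ℤ) :
    pathCount (N + 1) 0 x = pathCount N 0 x + pathCount N 1 x := by
  rw [pathCount_succ, sum_pathLetter]
  simp [PathLetter.rise, PathLetter.mark, PathLetter.opens, PathLetter.closes]
  ring

theorem pathCount_succ_succ (N h : ℕ) (x : ℤ) :
    pathCount (N + 1) (h + 1 : ℕ) x = (if h = 0 then pathCount N 1 (x - 1) else 0) +
      (pathCount N (h + 2 : ℕ) x + 2 * pathCount N (h + 1 : ℕ) x + pathCount N h x) := by
  rw [pathCount_succ, sum_pathLetter]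
  have h0 : (0 : ℤ) ≤ h + 1 := by positivity
  have h2 : (h : ℤ) + 1 + 1 = h + 2 := by ring
  have h3 : (h : ℤ) + 1 = 1 ↔ h = 0 := by omega
  simp [PathLetter.rise, PathLetter.mark, PathLetter.opens, PathLetter.closes, h0, h2, h3]
  split_ifs with hh
  · subst hh; simp; ring
  · ring

theorem evenPathCount_succ_zero (n : ℕ) (x : ℤ) :
    evenPathCount (n + 1) 0 x = evenPathCount n 0 x + evenPathCount n 1 x := by
  rw [evenPathCount_succ, sum_pathLetter]
  simp only [sum_pathLetter]
  simp [PathLetter.rise, PathLetter.mark, PathLetter.opens, PathLetter.closes]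
  ring

theorem evenPathCount_succ_succ (n h : ℕ) (x : ℤ) (hx : x < 2) :
    evenPathCount (n + 1) (h + 1 : ℕ) x =
      (if h = 0 then evenPathCount n 1 (x - 1) + (evenPathCount n 2 (x - 1) +
        2 * evenPathCount n 1 (x - 1) + evenPathCount n 0 (x - 1)) else 0) +
      (evenPathCount n (h + 2 : ℕ) x + 2 * evenPathCount n (h + 1 : ℕ) x +
        evenPathCount n h x) := by
  rw [evenPathCount_succ, sum_pathLetter]
  simp only [sum_pathLetter]
  have h0 : (0 : ℤ) ≤ h + 1 := by positivity
  have h2 : (h : ℤ) + 1 + 1 = h + 2 := by ring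
  have h3 : (h : ℤ) + 1 = 1 ↔ h = 0 := by omega
  -- A pair with both letters marked uses two marks, more than `x < 2` allows.
  have h4 : ∀ k, evenPathCount n k (x - 1 - 1) = 0 := fun k =>
    evenPathCount_eq_zero_of_neg n k (by omega)
  simp [PathLetter.rise, PathLetter.mark, PathLetter.opens, PathLetter.closes, h0, h2, h3, h4]
  split_ifs with hh
  · subst hh; simp; ring
  · ring

/-! ### Even words compared with ordinary paths -/

/-- Without marks every odd letter is flat, so deleting these letters loses nothing. Both counts
obey the same recurrence. -/
theorem evenPathCount_unmarked (n h : ℕ) : evenPathCount n h 0 = pathCount n h 0 := by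
  induction n generalizing h with
  | zero => rw [evenPathCount_zero, pathCount_zero]
  | succ n ih =>
    rcases h with _ | h
    · have h0 := ih 0
      have h1 := ih 1
      push_cast at h0 h1 ⊢
      rw [evenPathCount_succ_zero, pathCount_succ_zero, h0, h1]
    · rw [evenPathCount_succ_succ _ _ _ (by norm_num), pathCount_succ_succ, ih, ih, ih]
      congr 1
      rw [pathCount_eq_zero_of_neg n 1 (by norm_num)]
      simp [evenPathCount_eq_zero_of_neg]

/-- The two summands are the words with the mark at an even and at an odd position. In the
recurrence, the pairs that begin with the mark supply the extra term of the path of length `n + 1`.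
-/
theorem evenPathCount_marked (n h : ℕ) :
    evenPathCount n h 1 = pathCount n h 1 + pathCount (n + 1) h 1 := by
  induction n generalizing h with
  | zero =>
    rcases h with _ | h
    · push_cast
      rw [pathCount_succ_zero]
      simp [evenPathCount_zero, pathCount_zero]
    · rw [pathCount_succ_succ]
      simp [evenPathCount_zero, pathCount_zero]
  | succ n ih =>
    rcases h with _ | h
    · have h0 := ih 0
      have h1 := ih 1
      push_cast at h0 h1 ⊢
      have a := pathCount_succ_zero (n + 1) 1
      have b := pathCount_succ_zero n 1
      rw [evenPathCount_succ_zero, h0, h1]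
      linarith
    · rw [evenPathCount_succ_succ _ _ _ (by norm_num), ih, ih, ih]
      have a := pathCount_succ_succ (n + 1) h 1
      have b := pathCount_succ_succ n h 1
      have e1 := evenPathCount_unmarked n 1
      have e2 := evenPathCount_unmarked n 2
      have e0 := evenPathCount_unmarked n 0
      have e3 := pathCount_succ_succ n 0 0
      rw [pathCount_eq_zero_of_neg n 1 (by norm_num)] at e3
      push_cast at e0 e1 e2 e3
      simp only [sub_self, zero_add] at a b e3 ⊢
      rw [e0, e1, e2, a, b]
      split_ifs
      · rw [e3]; ring
      · ring

/-! ### Generating functions of paths -/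

-- The factor `X` makes each coefficient depend only on the preceding ones, at all heights, so the
-- recurrence has a single solution; closed forms need only be checked against it.
open PowerSeries in
theorem eq_of_path_recurrence (A F G : ℕ → PowerSeries ℤ)
    (hF0 : F 0 = A 0 + X * (F 0 + F 1)) (hG0 : G 0 = A 0 + X * (G 0 + G 1))
    (hF : ∀ h, F (h + 1) = A (h + 1) + X * (F (h + 2) + 2 * F (h + 1) + F h))
    (hG : ∀ h, G (h + 1) = A (h + 1) + X * (G (h + 2) + 2 * G (h + 1) + G h)) (h : ℕ) :
    F h = G h := by
  ext n
  induction n generalizing h with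
  | zero =>
    rcases h with _ | h
    · rw [hF0, hG0]; simp
    · rw [hF, hG]; simp
  | succ n ih =>
    rcases h with _ | h
    · rw [hF0, hG0]
      simp only [map_add, coeff_succ_X_mul, ih]
    · rw [hF, hG]
      simp only [map_add, coeff_succ_X_mul, ih, two_mul]

/-- The generating function of the Catalan numbers with integer coefficients. -/
noncomputable def catalanSeriesInt : PowerSeries ℤ :=
  PowerSeries.map (Nat.castRingHom ℤ) PowerSeries.catalanSeries

open PowerSeries in
theorem catalanSeriesInt_eq : catalanSeriesInt = 1 + X * catalanSeriesInt ^ 2 := by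
  have := congrArg (PowerSeries.map (Nat.castRingHom ℤ)) catalanSeries_sq_mul_X_add_one
  simp only [map_add, map_mul, map_pow, map_one, PowerSeries.map_X] at this
  unfold catalanSeriesInt
  linear_combination -this

theorem coeff_catalanSeriesInt (n : ℕ) :
    PowerSeries.coeff n catalanSeriesInt = (catalan n : ℤ) := by
  simp [catalanSeriesInt]

-- Splitting at the last visits to each height gives `h + 1` arms with series `C` on levels above 0,
-- up to the extra flat step, and `h` steps; the proof only verifies the recurrence.
open PowerSeries in
theorem mk_pathCount_unmarked (h : ℕ) :
    (PowerSeries.mk fun n => (pathCount n h 0 : ℤ)) =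
      X ^ h * catalanSeriesInt ^ (2 * h + 1) := by
  have hC := catalanSeriesInt_eq
  refine eq_of_path_recurrence (fun h => if h = 0 then 1 else 0)
    (fun h => PowerSeries.mk fun n => (pathCount n h 0 : ℤ))
    (fun h => X ^ h * catalanSeriesInt ^ (2 * h + 1)) ?_ ?_ ?_ ?_ h
  · ext n
    rcases n with _ | n
    · simp [pathCount_zero]
    · have := pathCount_succ_zero n 0
      simp only [CharP.cast_eq_zero, if_true, map_add, coeff_succ_X_mul, coeff_mk, this]
      simp [coeff_one]
  · simp only [if_true]
    linear_combination (1 + X * catalanSeriesInt) * hC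
  · intro h
    ext n
    rcases n with _ | n
    · simp [pathCount_zero]
      omega
    · have := pathCount_succ_succ n h 0
      rw [pathCount_eq_zero_of_neg n 1 (by norm_num)] at this
      simp only [map_add, coeff_succ_X_mul, coeff_mk, this, two_mul]
      simp
  · intro h
    simp only [Nat.add_eq_zero_iff, one_ne_zero, and_false, if_false]
    linear_combination (X ^ (h + 1) * catalanSeriesInt ^ (2 * h + 1) *
      (catalanSeriesInt + 1 + X * catalanSeriesInt ^ 2)) * hC

/-- The generating function of the marked paths from height `h`. -/
noncomputable def markedSeries : ℕ → PowerSeries ℤ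
  | 0 => PowerSeries.X ^ 3 * catalanSeriesInt ^ 6
  | h + 1 => PowerSeries.X ^ 2 * catalanSeriesInt ^ 6 * (1 - PowerSeries.X) *
      (PowerSeries.X * catalanSeriesInt ^ 2) ^ h

open PowerSeries in
theorem mk_pathCount_marked (h : ℕ) :
    (PowerSeries.mk fun n => (pathCount n h 1 : ℤ)) = markedSeries h := by
  have hC := catalanSeriesInt_eq
  refine eq_of_path_recurrence
    -- The source term is the mark itself: it is read at height 1 and leaves an unmarked path from
    -- height 1.
    (fun h => if h = 1 then X * PowerSeries.mk fun n => (pathCount n (1 : ℕ) 0 : ℤ) else 0)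
    (fun h => PowerSeries.mk fun n => (pathCount n h 1 : ℤ)) _ ?_ ?_ ?_ ?_ h
  · ext n
    rcases n with _ | n
    · simp [pathCount_zero]
    · have := pathCount_succ_zero n 1
      simp only [CharP.cast_eq_zero, zero_ne_one, if_false, map_add, coeff_succ_X_mul, coeff_mk,
        this]
      simp
  · simp only [zero_ne_one, if_false, markedSeries]
    ring
  · intro h
    ext n
    rcases n with _ | n
    · simp [pathCount_zero]
      split_ifs <;> simp
    · have := pathCount_succ_succ n h 1
      by_cases hh : h = 0
      · subst hh
        simp only [map_add, coeff_succ_X_mul, coeff_mk, this, two_mul, if_true]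
        simp
      · simp only [map_add, coeff_succ_X_mul, coeff_mk, this, two_mul, hh, if_false]
        simp [hh]
  · intro h
    rw [mk_pathCount_unmarked]
    rcases h with _ | h
    · simp only [markedSeries, zero_add, if_true]
      linear_combination (X ^ 2 * catalanSeriesInt ^ 3 * (1 + catalanSeriesInt +
        (1 - X) * catalanSeriesInt ^ 2 + (X - X ^ 2) * catalanSeriesInt ^ 3)) * hC
    · simp only [markedSeries, Nat.add_eq_right, Nat.add_eq_zero_iff, one_ne_zero, and_false,
        if_false]
      linear_combination (X ^ 2 * catalanSeriesInt ^ 6 * (1 - X) * (X * catalanSeriesInt ^ 2) ^ h *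
        X * (catalanSeriesInt + 1 + X * catalanSeriesInt ^ 2)) * hC

/-! ### Catalan and binomial forms -/

-- Since XC^2 = C-1, the left side is X^2(C-1)^3, which becomes linear in C after reducing X^2C^3
-- and XC^2.
open PowerSeries in
theorem X_pow_five_mul_catalanSeriesInt_pow_six :
    X ^ 2 * (X ^ 3 * catalanSeriesInt ^ 6) =
      catalanSeriesInt - 4 * (X * catalanSeriesInt) + 3 * (X ^ 2 * catalanSeriesInt) -
        1 + 3 * X - X ^ 2 := by
  have h1 : X * catalanSeriesInt ^ 2 = catalanSeriesInt - 1 := by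
    linear_combination -catalanSeriesInt_eq
  have h2 : X ^ 2 * catalanSeriesInt ^ 3 = catalanSeriesInt - 1 - X * catalanSeriesInt := by
    linear_combination (X * catalanSeriesInt + 1) * h1
  linear_combination X ^ 2 * ((X * catalanSeriesInt ^ 2) ^ 2 +
    X * catalanSeriesInt ^ 2 * (catalanSeriesInt - 1) + (catalanSeriesInt - 1) ^ 2) * h1 +
    h2 - 3 * X * h1

open PowerSeries in
theorem coeff_pathCount_marked (n : ℕ) :
    (pathCount n 0 1 : ℤ) = coeff n (X ^ 3 * catalanSeriesInt ^ 6) := by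
  have := congrArg (coeff n) (mk_pathCount_marked 0)
  simpa [markedSeries] using this

open PowerSeries in
theorem pathCount_marked_eq_catalan {n : ℕ} (hn : 1 ≤ n) :
    (pathCount n 0 1 : ℤ) = catalan (n + 2) - 4 * catalan (n + 1) + 3 * catalan n := by
  have h := congrArg (coeff (n + 2)) X_pow_five_mul_catalanSeriesInt_pow_six
  have e4 : (4 : PowerSeries ℤ) = C (4 : ℤ) := rfl
  have e3 : (3 : PowerSeries ℤ) = C (3 : ℤ) := rfl
  rw [e4, e3, coeff_X_pow_mul, ← coeff_pathCount_marked] at h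
  simp only [map_add, map_sub, coeff_C_mul, coeff_X_pow_mul, coeff_catalanSeriesInt, coeff_one,
    coeff_X, coeff_X_pow] at h
  rw [show n + 2 = (n + 1) + 1 from rfl, coeff_succ_X_mul, coeff_catalanSeriesInt] at h
  simp at h
  -- The polynomial part contributes in degree `n + 2` only for `n = 0`, which `hn` excludes.
  rw [h, if_neg (by omega), sub_zero]

theorem three_div_mul_intChoose {n : ℕ} (hn : 1 ≤ n) :
    3 / (n : ℚ) * (intChoose (2 * n) ((n : ℤ) - 3) : ℚ) =
      catalan (n + 2) - 4 * catalan (n + 1) + 3 * catalan n := by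
  have hcat : ∀ m : ℕ, (catalan m : ℚ) = Nat.centralBinom m / (m + 1) := fun m => by
    rw [eq_div_iff (by positivity), ← succ_mul_catalan_eq_centralBinom]
    push_cast
    ring
  have hcb : ∀ m : ℕ, (Nat.centralBinom (m + 1) : ℚ) =
      2 * (2 * m + 1) * Nat.centralBinom m / (m + 1) := fun m => by
    rw [eq_div_iff (by positivity)]
    have := Nat.succ_mul_centralBinom_succ m
    have h2 : ((m + 1) * Nat.centralBinom (m + 1) : ℚ) = 2 * (2 * m + 1) * Nat.centralBinom m := by
      exact_mod_cast this
    linarith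
  rw [hcat, hcat, hcat, hcb (n + 1), hcb n]
  rcases Nat.lt_or_ge n 3 with h | h
  · have : intChoose (2 * n) ((n : ℤ) - 3) = 0 := by
      unfold intChoose
      rw [if_neg (by omega)]
    rw [this]
    interval_cases n <;> norm_num <;> ring
  · obtain ⟨k, rfl⟩ := Nat.exists_eq_add_of_le' h
    have e : intChoose (2 * (k + 3)) (((k + 3 : ℕ) : ℤ) - 3) = (2 * k + 6).choose k := by
      unfold intChoose
      have : ((k + 3 : ℕ) : ℤ) - 3 = k := by push_cast; ring
      rw [this, if_pos (by positivity), Int.toNat_natCast]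
      rfl
    -- Three successive ratios lead from `choose (2k+6) k` to the central binomial coefficient, so
    -- both sides become rational multiples of one number.
    have a1 := Nat.choose_succ_right_eq (2 * k + 6) k
    have a2 := Nat.choose_succ_right_eq (2 * k + 6) (k + 1)
    have a3 := Nat.choose_succ_right_eq (2 * k + 6) (k + 2)
    have hc : Nat.centralBinom (k + 3) = (2 * k + 6).choose (k + 2 + 1) := rfl
    rw [← hc, show 2 * k + 6 - (k + 2) = k + 4 by omega] at a3
    rw [show 2 * k + 6 - (k + 1) = k + 5 by omega] at a2
    rw [show 2 * k + 6 - k = k + 6 by omega] at a1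
    rw [e]
    rw [show k + 1 + 1 = k + 2 from rfl] at a2
    generalize Nat.choose (2 * k + 6) k = u at *
    generalize Nat.choose (2 * k + 6) (k + 1) = v at *
    generalize Nat.choose (2 * k + 6) (k + 2) = w at *
    generalize Nat.centralBinom (k + 3) = c at *
    have b1 : (v : ℚ) = u * (k + 6) / (k + 1) := by
      rw [eq_div_iff (by positivity)]; exact_mod_cast a1
    have b2 : (w : ℚ) = v * (k + 5) / (k + 2) := by
      rw [eq_div_iff (by positivity)]; exact_mod_cast a2
    have b3 : (c : ℚ) = w * (k + 4) / (k + 3) := by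
      rw [eq_div_iff (by positivity)]; exact_mod_cast a3
    rw [b3, b2, b1]
    push_cast
    field_simp
    ring

/-! ### Permutations monotone on color classes -/

/-- A map given by strictly increasing bijections between the fibers of two colorings exists. -/
theorem exists_perm_strictMono_on_fibers {α ι : Type*} [Finite α] [LinearOrder α] (f g : α → ι)
    (hc : ∀ i, Nat.card {x // f x = i} = Nat.card {x // g x = i}) :
    ∃ π : Equiv.Perm α, (∀ x, g (π x) = f x) ∧ ∀ x y, f x = f y → x < y → π x < π y := by
  classical
  have := Fintype.ofFinite α
  have e : ∀ i, Nonempty ({x // f x = i} ≃o {x // g x = i}) := fun i => by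
    have h := hc i
    rw [Nat.card_eq_fintype_card, Nat.card_eq_fintype_card] at h
    exact ⟨(Fintype.orderIsoFinOfCardEq _ h).symm.trans (Fintype.orderIsoFinOfCardEq _ rfl)⟩
  let E : ∀ i, {x // f x = i} ≃o {x // g x = i} := fun i => (e i).some
  let π : Equiv.Perm α := (Equiv.sigmaFiberEquiv f).symm.trans
    ((Equiv.sigmaCongrRight fun i => (E i).toEquiv).trans (Equiv.sigmaFiberEquiv g))
  have hπ : ∀ i (x : {x // f x = i}), π x.1 = (E i x).1 := by
    rintro _ ⟨x, rfl⟩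
    rfl
  refine ⟨π, fun x => ?_, fun x y hxy hlt => ?_⟩
  · rw [hπ (f x) ⟨x, rfl⟩]
    exact (E (f x) ⟨x, rfl⟩).2
  · rw [hπ (f x) ⟨x, rfl⟩, hπ (f x) ⟨y, hxy.symm⟩]
    exact (E (f x)).strictMono hlt

theorem perm_eq_of_strictMono_on_fibers {α ι : Type*} [Finite α] [LinearOrder α] {f g : α → ι}
    {π σ : Equiv.Perm α} (hπ : ∀ x, g (π x) = f x) (hσ : ∀ x, g (σ x) = f x)
    (mπ : ∀ x y, f x = f y → x < y → π x < π y) (mσ : ∀ x y, f x = f y → x < y → σ x < σ y) :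
    π = σ := by
  have key : ∀ τ : Equiv.Perm α, (∀ x, g (τ x) = f x) → (∀ x y, f x = f y → x < y → τ x < τ y) →
      ∀ i, ∃ E : {x // f x = i} ≃o {x // g x = i}, ∀ x, (E x).1 = τ x.1 := by
    intro τ hτ mτ i
    let F : {x // f x = i} ≃ {x // g x = i} := τ.subtypeEquiv fun x => by rw [hτ]
    have hF : StrictMono F := fun x y hxy => mτ x.1 y.1 (x.2.trans y.2.symm) hxy
    exact ⟨hF.orderIsoOfSurjective F F.surjective, fun x => rfl⟩
  ext x
  obtain ⟨E, hE⟩ := key π hπ mπ (f x)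
  obtain ⟨E', hE'⟩ := key σ hσ mσ (f x)
  rw [← hE ⟨x, rfl⟩, ← hE' ⟨x, rfl⟩, Subsingleton.elim E E']

open Finset

theorem card_filter_and_add_card_filter_and_not {α : Type*} [Fintype α] (p q : α → Prop)
    [DecidablePred p] [DecidablePred q] :
    #{x | p x ∧ q x} + #{x | p x ∧ ¬ q x} = #{x | p x} := by
  rw [← filter_filter, ← filter_filter]
  exact card_filter_add_card_filter_not _

theorem card_filter_perm {α : Type*} [Fintype α] (π : Equiv.Perm α) (p : α → Prop)
    [DecidablePred p] : #{x | p (π x)} = #{x | p x} :=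
  card_equiv π (by simp)

/-- As many entries cross a gap of a permutation upwards as downwards. -/
theorem card_crossing {N : ℕ} (π : Equiv.Perm (Fin N)) (m : ℕ) :
    #{i | i.1 < m ∧ ¬ (π i).1 < m} = #{i | (π i).1 < m ∧ ¬ i.1 < m} := by
  have h1 := card_filter_and_add_card_filter_and_not (fun i : Fin N => i.1 < m)
    (fun i => (π i).1 < m)
  have h2 := card_filter_and_add_card_filter_and_not (fun i : Fin N => (π i).1 < m)
    (fun i => i.1 < m)
  have h3 := card_filter_perm π (fun i : Fin N => i.1 < m)
  simp only [and_comm (a := (π _).1 < m) (b := (_ : Fin N).1 < m)] at h2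
  have h4 : #{i | (π i).1 < m ∧ ¬ i.1 < m} = #{i | ¬ i.1 < m ∧ (π i).1 < m} := by
    simp only [and_comm]
  simp only [and_comm (a := ¬ (_ : Fin N).1 < m)] at h4
  omega

/-! ### One occurrence of 321 and the center -/

/-- Three entries of `π` in decreasing order. -/
def IsDecreasingTriple {N : ℕ} (π : Equiv.Perm (Fin N)) (i j k : Fin N) : Prop :=
  i < j ∧ j < k ∧ π j < π i ∧ π k < π j

theorem mem_patternOccurrences_pattern321 {N : ℕ} (π : Equiv.Perm (Fin N)) (f : Fin 3 ↪o Fin N) :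
    f ∈ patternOccurrences pattern321 π ↔ IsDecreasingTriple π (f 0) (f 1) (f 2) := by
  have hq : ∀ a b : Fin 3, pattern321 a < pattern321 b ↔ b < a := by decide
  simp only [patternOccurrences, Set.mem_ofPred_eq, hq, IsDecreasingTriple]
  constructor
  · intro h
    exact ⟨f.strictMono (by decide), f.strictMono (by decide), (h 1 0).2 (by decide),
      (h 2 1).2 (by decide)⟩
  · rintro ⟨-, -, h1, h2⟩
    have h3 := h2.trans h1
    intro a b
    fin_cases a <;> fin_cases b <;> simp [h1, h2, h3, h1.le, h2.le, h3.le]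

theorem hasOccurrences_pattern321_one_iff {N : ℕ} (π : Equiv.Perm (Fin N)) :
    HasOccurrences pattern321 1 π ↔ ∃ i j k, IsDecreasingTriple π i j k ∧
      ∀ i' j' k', IsDecreasingTriple π i' j' k' → i' = i ∧ j' = j ∧ k' = k := by
  have mk : ∀ i j k, IsDecreasingTriple π i j k → ∃ f ∈ patternOccurrences pattern321 π,
      f 0 = i ∧ f 1 = j ∧ f 2 = k := by
    intro i j k h
    have hm : StrictMono ![i, j, k] := by
      rw [Fin.strictMono_iff_lt_succ]
      intro a
      fin_cases a
      · exact h.1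
      · exact h.2.1
    refine ⟨OrderEmbedding.ofStrictMono _ hm, ?_, rfl, rfl, rfl⟩
    rw [mem_patternOccurrences_pattern321]
    exact h
  rw [HasOccurrences, Set.ncard_eq_one]
  constructor
  · rintro ⟨f, hf⟩
    have h0 : f ∈ patternOccurrences pattern321 π := by rw [hf]; rfl
    refine ⟨f 0, f 1, f 2, (mem_patternOccurrences_pattern321 π f).1 h0, fun i j k h => ?_⟩
    obtain ⟨g, hg, rfl, rfl, rfl⟩ := mk i j k h
    rw [hf, Set.mem_singleton_iff] at hg
    subst hg
    exact ⟨rfl, rfl, rfl⟩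
  · rintro ⟨i, j, k, h, hu⟩
    obtain ⟨f, hf, rfl, rfl, rfl⟩ := mk i j k h
    refine ⟨f, Set.eq_singleton_iff_unique_mem.2 ⟨hf, fun g hg => ?_⟩⟩
    obtain ⟨h0, h1, h2⟩ := hu _ _ _ ((mem_patternOccurrences_pattern321 π g).1 hg)
    ext a
    fin_cases a
    · exact congrArg Fin.val h0
    · exact congrArg Fin.val h1
    · exact congrArg Fin.val h2

/-- The fixed point `b` is crossed by exactly one deficiency of `π`, and apart from `b` the
permutation increases both on its deficiencies and on its other positions. -/
structure HasCenter {N : ℕ} (π : Equiv.Perm (Fin N)) (b : Fin N) : Prop where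
  fixed : π b = b
  crossing : #{i | (π i).1 < b.1 ∧ ¬ i.1 < b.1} = 1
  deficient : ∀ x y, π x < x → π y < y → x < y → π x < π y
  excedant : ∀ x y, x ≤ π x → y ≤ π y → x ≠ b → y ≠ b → x < y → π x < π y

theorem HasCenter.of_unique {N : ℕ} {π : Equiv.Perm (Fin N)} {i j k : Fin N}
    (h : IsDecreasingTriple π i j k)
    (hu : ∀ i' j' k', IsDecreasingTriple π i' j' k' → i' = i ∧ j' = j ∧ k' = k) :
    HasCenter π j := by
  obtain ⟨hij, hjk, hπij, hπjk⟩ := h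
  have e1 : ({x | x.1 < j.1 ∧ ¬ (π x).1 < (π j).1} : Finset (Fin N)) = {i} := by
    ext x
    simp only [mem_filter, mem_univ, true_and, mem_singleton]
    constructor
    · rintro ⟨hx, hπ⟩
      have : π x ≠ π j := fun e => hx.ne (congrArg Fin.val (π.injective e))
      exact (hu x j k ⟨hx, hjk, lt_of_le_of_ne (not_lt.1 hπ) this.symm, hπjk⟩).1
    · rintro rfl
      exact ⟨hij, not_lt.2 hπij.le⟩
  have e2 : ({x | (π x).1 < (π j).1 ∧ ¬ x.1 < j.1} : Finset (Fin N)) = {k} := by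
    ext x
    simp only [mem_filter, mem_univ, true_and, mem_singleton]
    constructor
    · rintro ⟨hπ, hx⟩
      have : x ≠ j := fun e => by rw [e] at hπ; exact lt_irrefl _ hπ
      exact (hu i j x ⟨hij, lt_of_le_of_ne (not_lt.1 hx) this.symm, hπij, hπ⟩).2.2
    · rintro rfl
      exact ⟨hπjk, not_lt.2 hjk.le⟩
  -- Going from positions before `j` to values below `π j` loses only `i` and gains only `k`, so the
  -- two counts agree.
  have hfix : π j = j := by
    have h1 := card_filter_and_add_card_filter_and_not (fun x : Fin N => x.1 < j.1)
      (fun x => (π x).1 < (π j).1)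
    have h2 := card_filter_and_add_card_filter_and_not (fun x : Fin N => (π x).1 < (π j).1)
      (fun x => x.1 < j.1)
    have h3 := card_filter_perm π (fun x : Fin N => x.1 < (π j).1)
    have h4 : ∀ y : Fin N, #{x : Fin N | x.1 < y.1} = y.1 := fun y => by
      have : ({x : Fin N | x.1 < y.1} : Finset (Fin N)) = Iio y := by
        ext x
        simp
      rw [this, Fin.card_Iio]
    have h5 : #{x | (π x).1 < (π j).1 ∧ x.1 < j.1} = #{x | x.1 < j.1 ∧ (π x).1 < (π j).1} := by
      congr 1
      ext x
      simp [and_comm]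
    rw [e1, h4, card_singleton] at h1
    rw [e2, h3, h4, card_singleton, h5] at h2
    exact Fin.ext (by omega)
  refine ⟨hfix, ?_, fun x y hx hy hxy => ?_, fun x y hx hy hxj hyj hxy => ?_⟩
  · rw [hfix] at e2
    rw [e2, card_singleton]
  · by_contra hlt
    have hne : π x ≠ π y := fun e => hxy.ne (π.injective e)
    have hyx : π y < π x := lt_of_le_of_ne (not_lt.1 hlt) hne.symm
    -- The deficiency `x` crosses the gap before `x` downwards, so some `z` crosses it upwards; then
    -- `z, x, y` is a 321 whose middle is not fixed.
    have hpos : 0 < #{i | i.1 < x.1 ∧ ¬ (π i).1 < x.1} := by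
      rw [card_crossing]
      exact card_pos.2 ⟨x, by simpa using hx⟩
    obtain ⟨z, hz⟩ := card_pos.1 hpos
    simp only [mem_filter, mem_univ, true_and] at hz
    have := (hu z x y ⟨hz.1, hxy, lt_of_lt_of_le hx (not_lt.1 hz.2), hyx⟩).2.1
    rw [this, hfix] at hx
    exact lt_irrefl _ hx
  · by_contra hlt
    have hne : π x ≠ π y := fun e => hxy.ne (π.injective e)
    have hyx : π y < π x := lt_of_le_of_ne (not_lt.1 hlt) hne.symm
    -- Dually, `x` crosses the gap before `π y` upwards, and an entry crossing it downwards
    -- completes a 321 with middle `y ≠ j`.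
    have hpos : 0 < #{i | (π i).1 < (π y).1 ∧ ¬ i.1 < (π y).1} := by
      rw [← card_crossing]
      exact card_pos.2 ⟨x, by simpa using ⟨hxy.trans_le hy, hyx.le⟩⟩
    obtain ⟨z, hz⟩ := card_pos.1 hpos
    simp only [mem_filter, mem_univ, true_and] at hz
    have hzy : z ≠ y := fun e => by rw [e] at hz; exact lt_irrefl _ hz.1
    have hyz : y < z := lt_of_le_of_ne (hy.trans (not_lt.1 hz.2)) hzy.symm
    exact hyj (hu x y z ⟨hxy, hyz, hyx, hz.1⟩).2.1

/-- If the middle is a deficiency, so is the last entry; otherwise the first entry is an excedance.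
Either way two entries of one increasing class are inverted, unless the middle is `b`. -/
theorem HasCenter.middle_eq {N : ℕ} {π : Equiv.Perm (Fin N)} {b i j k : Fin N}
    (H : HasCenter π b) (h : IsDecreasingTriple π i j k) : j = b := by
  obtain ⟨hij, hjk, hπij, hπjk⟩ := h
  have D := H.deficient
  have E := H.excedant
  by_contra hj
  rcases lt_or_ge (π j) j with h1 | h1
  · have hk : ¬ π k < k := fun h => lt_asymm (D j k h1 h hjk) hπjk
    omega
  · have hi : ¬ i ≤ π i ∨ i = b := by
      by_contra! hi
      exact lt_asymm (E i j hi.1 h1 hi.2 hj hij) hπij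
    rcases hi with hi | hi
    · omega
    · have := H.fixed
      rw [← hi] at this
      omega

theorem HasCenter.hasOccurrences {N : ℕ} {π : Equiv.Perm (Fin N)} {b : Fin N}
    (H : HasCenter π b) : HasOccurrences pattern321 1 π := by
  rw [hasOccurrences_pattern321_one_iff]
  obtain ⟨k, hk⟩ := card_eq_one.1 H.crossing
  obtain ⟨i, hi⟩ := card_eq_one.1 ((card_crossing π b.1).trans H.crossing)
  have hk' : ∀ x, (π x < b ∧ ¬ x < b) ↔ x = k := fun x => by
    simpa using Finset.ext_iff.1 hk x
  have hi' : ∀ x, (x < b ∧ ¬ π x < b) ↔ x = i := fun x => by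
    simpa using Finset.ext_iff.1 hi x
  have hb := H.fixed
  have hne : ∀ x, x ≠ b → π x ≠ b := fun x hx e => hx (π.injective (e.trans hb.symm))
  refine ⟨i, b, k, ?_, fun x y z h => ?_⟩
  · have h1 := (hk' k).2 rfl
    have h2 := (hi' i).2 rfl
    have h3 := hne i h2.1.ne
    have h4 : k ≠ b := fun e => by rw [e, hb] at h1; exact lt_irrefl _ h1.1
    refine ⟨h2.1, ?_, ?_, ?_⟩
    · omega
    · rw [hb]; omega
    · rw [hb]; exact h1.1
  · obtain rfl := H.middle_eq h
    obtain ⟨hij, hjk, hπij, hπjk⟩ := h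
    rw [hb] at hπij hπjk
    exact ⟨(hi' x).1 ⟨hij, by omega⟩, rfl, (hk' z).1 ⟨hπjk, by omega⟩⟩

theorem HasCenter.unique {N : ℕ} {π : Equiv.Perm (Fin N)} {b c : Fin N}
    (H : HasCenter π b) (H' : HasCenter π c) : b = c := by
  obtain ⟨i, j, k, h, -⟩ := (hasOccurrences_pattern321_one_iff π).1 H.hasOccurrences
  rw [← H.middle_eq h, H'.middle_eq h]

theorem hasOccurrences_iff_exists_hasCenter {N : ℕ} (π : Equiv.Perm (Fin N)) :
    HasOccurrences pattern321 1 π ↔ ∃ b, HasCenter π b := by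
  refine ⟨fun h => ?_, fun ⟨b, hb⟩ => hb.hasOccurrences⟩
  obtain ⟨i, j, k, h, hu⟩ := (hasOccurrences_pattern321_one_iff π).1 h
  exact ⟨j, HasCenter.of_unique h hu⟩

/-! ### From permutations to marked paths -/

/-- The word of a permutation with a marked point: the letter at `i` steps up if `i` is the value
of a deficiency, and steps down if `i` is the position of a deficiency. -/
def centerWord {N : ℕ} (π : Equiv.Perm (Fin N)) (b i : Fin N) : PathLetter :=
  if i = b then none else some (decide (i < π.symm i), decide (π i < i))

theorem pathHeight_eq_card_sub_card {N : ℕ} (w : Fin N → PathLetter) (m : ℕ) :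
    pathHeight w m = (#{i | i.1 < m ∧ (w i).opens = true} : ℤ) -
      #{i | i.1 < m ∧ (w i).closes = true} := by
  simp only [pathHeight, PathLetter.rise, card_filter, Nat.cast_sum, ← sum_sub_distrib]
  refine sum_congr rfl fun i _ => ?_
  by_cases h : i.1 < m <;> simp [h]

/-- A deficiency opens at its value and closes later, at its position. Those closed before `m`
cancel, leaving those that cross the gap. -/
theorem pathHeight_eq_card_crossing {N : ℕ} {π : Equiv.Perm (Fin N)} {w : Fin N → PathLetter}
    (ho : ∀ i, (w i).opens = true ↔ i < π.symm i) (hc : ∀ i, (w i).closes = true ↔ π i < i)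
    (m : ℕ) : pathHeight w m = #{i | (π i).1 < m ∧ ¬ i.1 < m} := by
  rw [pathHeight_eq_card_sub_card]
  simp only [ho, hc]
  have h1 := card_filter_perm π fun i : Fin N => i.1 < m ∧ i < π.symm i
  have h2 := card_filter_and_add_card_filter_and_not
    (fun i : Fin N => (π i).1 < m ∧ π i < π.symm (π i)) (fun i => i.1 < m)
  have h3 : #{i : Fin N | ((π i).1 < m ∧ π i < π.symm (π i)) ∧ i.1 < m} =
      #{i : Fin N | i.1 < m ∧ π i < i} := by
    congr 1
    ext i
    simp only [Equiv.symm_apply_apply, mem_filter, mem_univ, true_and]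
    omega
  have h4 : #{i : Fin N | ((π i).1 < m ∧ π i < π.symm (π i)) ∧ ¬ i.1 < m} =
      #{i | (π i).1 < m ∧ ¬ i.1 < m} := by
    congr 1
    ext i
    simp only [Equiv.symm_apply_apply, mem_filter, mem_univ, true_and]
    omega
  omega

section CenterWord

variable {N : ℕ} {π : Equiv.Perm (Fin N)} {b : Fin N}

theorem centerWord_eq_none {i : Fin N} : centerWord π b i = none ↔ i = b := by
  simp [centerWord]

theorem HasCenter.opens_centerWord (H : HasCenter π b) (i : Fin N) :
    (centerWord π b i).opens = true ↔ i < π.symm i := by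
  unfold centerWord
  split_ifs with h
  · have : π.symm b = b := by rw [Equiv.symm_apply_eq, H.fixed]
    simp [PathLetter.opens, h, this]
  · simp [PathLetter.opens]

theorem HasCenter.closes_centerWord (H : HasCenter π b) (i : Fin N) :
    (centerWord π b i).closes = true ↔ π i < i := by
  unfold centerWord
  split_ifs with h
  · simp [PathLetter.closes, h, H.fixed]
  · simp [PathLetter.closes]

theorem HasCenter.isMarkedPath (H : HasCenter π b) : IsMarkedPath 0 1 (centerWord π b) := by
  have hh := pathHeight_eq_card_crossing H.opens_centerWord H.closes_centerWord
  refine ⟨fun m => ?_, fun i hi => ?_, fun i hi => ?_, ?_, ?_⟩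
  · rw [hh]
    positivity
  · rw [hh, zero_add]
    rw [H.closes_centerWord] at hi
    have : 0 < #{j | (π j).1 < i.1 ∧ ¬ j.1 < i.1} := card_pos.2 ⟨i, by simpa using hi⟩
    omega
  · rw [centerWord_eq_none] at hi
    rw [hh, hi, H.crossing]
    simp
  · rw [hh]
    simp
  · simp [PathLetter.mark, centerWord_eq_none]

/-- The color of a position of a word: whether it is marked, and whether it steps down. -/
def positionColor (w : Fin N → PathLetter) (i : Fin N) : Bool × Bool :=
  (decide (w i = none), (w i).closes)

/-- The color of a value of a word: whether it is marked, and whether it steps up. -/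
def valueColor (w : Fin N → PathLetter) (i : Fin N) : Bool × Bool :=
  (decide (w i = none), (w i).opens)

theorem HasCenter.valueColor_apply (H : HasCenter π b) (x : Fin N) :
    valueColor (centerWord π b) (π x) = positionColor (centerWord π b) x := by
  refine Prod.ext ?_ ?_
  · rw [Bool.eq_iff_iff]
    simp only [valueColor, positionColor, decide_eq_true_iff, centerWord_eq_none]
    rw [← H.fixed, π.injective.eq_iff, H.fixed]
  · rw [Bool.eq_iff_iff]
    simp only [valueColor, positionColor, H.opens_centerWord, H.closes_centerWord,
      Equiv.symm_apply_apply]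

theorem HasCenter.lt_of_positionColor_eq (H : HasCenter π b) (x y : Fin N)
    (h : positionColor (centerWord π b) x = positionColor (centerWord π b) y) (hxy : x < y) :
    π x < π y := by
  have h1 := congrArg Prod.fst h
  have h2 := congrArg Prod.snd h
  simp only [positionColor, decide_eq_decide, centerWord_eq_none] at h1
  simp only [positionColor] at h2
  rw [Bool.eq_iff_iff, H.closes_centerWord, H.closes_centerWord] at h2
  by_cases hx : π x < x
  · exact H.deficient x y hx (h2.1 hx) hxy
  · have hxb : x ≠ b := fun e => hxy.ne (e.trans (h1.1 e).symm)
    exact H.excedant x y (not_lt.1 hx) (not_lt.1 fun e => hx (h2.2 e)) hxb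
      (fun e => hxb (h1.2 e)) hxy

theorem HasCenter.eq_of_centerWord_eq {σ : Equiv.Perm (Fin N)} {c : Fin N} (H : HasCenter π b)
    (H' : HasCenter σ c) (h : centerWord π b = centerWord σ c) : π = σ := by
  have v := H'.valueColor_apply
  have m := H'.lt_of_positionColor_eq
  rw [← h] at v m
  exact perm_eq_of_strictMono_on_fibers H.valueColor_apply v H.lt_of_positionColor_eq m

end CenterWord

/-! ### From marked paths back to permutations -/

theorem IsMarkedPath.card_fibers_eq {N : ℕ} {x : ℤ} {w : Fin N → PathLetter}
    (H : IsMarkedPath 0 x w) (c : Bool × Bool) :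
    #{i | positionColor w i = c} = #{i | valueColor w i = c} := by
  have hn : ∀ i, w i = none → (w i).opens = false ∧ (w i).closes = false := by
    intro i hi
    simp [hi, PathLetter.opens, PathLetter.closes]
  have hfin := H.final
  rw [pathHeight_eq_card_sub_card] at hfin
  simp only [Fin.is_lt, true_and] at hfin
  have hoc : #{i | (w i).opens = true} = #{i | (w i).closes = true} := by omega
  obtain ⟨c1, c2⟩ := c
  simp only [positionColor, valueColor, Prod.mk.injEq]
  -- Each flag is false at the mark, so the fiber sizes depend only on how often it is true.
  have key : ∀ f : Fin N → Bool, (∀ i, w i = none → f i = false) →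
      #{i | decide (w i = none) = c1 ∧ f i = c2} = if c1 then
        (if c2 then 0 else #{i | w i = none}) else
        (if c2 then #{i | f i = true} else
          #{i | ¬ w i = none} - #{i | f i = true}) := by
    intro f hf
    rcases c1 with _ | _ <;> rcases c2 with _ | _
    · have h1 := card_filter_and_add_card_filter_and_not (fun i => ¬ w i = none)
        (fun i => f i = true)
      have h2 : #{i | ¬ w i = none ∧ f i = true} = #{i | f i = true} := by
        congr 1
        ext i
        have := hf i
        simp only [mem_filter, mem_univ, true_and, and_iff_right_iff_imp]
        intro h h'
        simp [this h'] at h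
      have h3 : #{i | decide (w i = none) = false ∧ f i = false} =
          #{i | ¬ w i = none ∧ ¬ f i = true} := by
        congr 1
        ext i
        simp
      simp only [Bool.false_eq_true, if_false]
      omega
    · simp only [Bool.false_eq_true, if_false, if_true, decide_eq_false_iff_not]
      congr 1
      ext i
      have := hf i
      simp only [mem_filter, mem_univ, true_and, and_iff_right_iff_imp]
      intro h h'
      simp [this h'] at h
    · simp only [Bool.false_eq_true, if_false, if_true]
      congr 1
      ext i
      simpa using hf i
    · simp only [if_true, card_eq_zero, filter_eq_empty_iff, decide_eq_true_iff]
      rintro i - ⟨h1, h2⟩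
      simp [hf i h1] at h2
  rw [key _ fun i hi => (hn i hi).2, key _ fun i hi => (hn i hi).1, hoc]

theorem card_filter_lt_fiber {N : ℕ} {ι : Type*} [DecidableEq ι] {π : Equiv.Perm (Fin N)}
    {f g : Fin N → ι} (hπ : ∀ x, g (π x) = f x) (mπ : ∀ x y, f x = f y → x < y → π x < π y)
    (x : Fin N) : #{j | j.1 < x.1 ∧ f j = f x} = #{v | v.1 < (π x).1 ∧ g v = f x} := by
  rw [← card_filter_perm π fun v : Fin N => v.1 < (π x).1 ∧ g v = f x]
  congr 1
  ext j
  simp only [hπ, mem_filter, mem_univ, true_and]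
  refine and_congr_left fun hj => ⟨fun h => mπ j x hj h, fun h => ?_⟩
  by_contra hlt
  rcases (not_lt.1 hlt).lt_or_eq with h' | h'
  · exact lt_asymm h (mπ x j hj.symm h')
  · rw [Fin.ext h'] at h
    exact lt_irrefl _ h

theorem card_filter_lt_lt_card_filter_lt {N : ℕ} {q : Fin N → Prop} [DecidablePred q]
    {u x : Fin N} (hu : q u) (hux : u < x) :
    #{v | v.1 < u.1 ∧ q v} < #{v | v.1 < x.1 ∧ q v} := by
  refine card_lt_card ?_
  rw [Finset.ssubset_iff_of_subset]
  · exact ⟨u, by simp [hu, hux], by simp⟩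
  · intro v
    simp only [mem_filter, mem_univ, true_and]
    rintro ⟨h1, h2⟩
    exact ⟨by omega, h2⟩

theorem card_filter_lt_le_card_filter_lt {N : ℕ} {q : Fin N → Prop} [DecidablePred q]
    {u x : Fin N} (hux : u ≤ x) :
    #{v | v.1 < u.1 ∧ q v} ≤ #{v | v.1 < x.1 ∧ q v} := by
  refine card_le_card fun v => ?_
  simp only [mem_filter, mem_univ, true_and]
  rintro ⟨h1, h2⟩
  exact ⟨by omega, h2⟩

theorem card_filter_lt_split {N : ℕ} (w : Fin N → PathLetter) (f : PathLetter → Bool)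
    (hf : f none = false) (m : ℕ) :
    #{i | i.1 < m ∧ f (w i) = true} + #{i | i.1 < m ∧ (decide (w i = none), f (w i)) = (false, false)} +
      #{i | i.1 < m ∧ w i = none} = #{i : Fin N | i.1 < m} := by
  have h1 := card_filter_and_add_card_filter_and_not (fun i : Fin N => i.1 < m)
    (fun i => w i = none)
  have h2 := card_filter_and_add_card_filter_and_not
    (fun i : Fin N => i.1 < m ∧ ¬ w i = none) (fun i => f (w i) = true)
  have h3 : #{i : Fin N | (i.1 < m ∧ ¬ w i = none) ∧ f (w i) = true} =
      #{i | i.1 < m ∧ f (w i) = true} := by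
    congr 1
    ext i
    by_cases h : w i = none <;> simp [hf, h]
  have h4 : #{i : Fin N | (i.1 < m ∧ ¬ w i = none) ∧ ¬ f (w i) = true} =
      #{i | i.1 < m ∧ (decide (w i = none), f (w i)) = (false, false)} := by
    congr 1
    ext i
    simp [and_assoc]
  omega

theorem IsMarkedPath.exists_hasCenter {N : ℕ} {w : Fin N → PathLetter}
    (H : IsMarkedPath 0 1 w) : ∃ π b, HasCenter π b ∧ centerWord π b = w := by
  obtain ⟨b, hb⟩ : ∃ b, ∀ i, w i = none ↔ i = b := by
    have h := H.marks
    simp only [PathLetter.mark, sum_boole] at h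
    obtain ⟨b, hb⟩ := card_eq_one.1 (by exact_mod_cast h : #{i | w i = none} = 1)
    exact ⟨b, fun i => by simpa using Finset.ext_iff.1 hb i⟩
  obtain ⟨π, hπ, mπ⟩ := exists_perm_strictMono_on_fibers (positionColor w) (valueColor w)
    fun c => by
      rw [Nat.card_eq_fintype_card, Nat.card_eq_fintype_card, Fintype.card_subtype,
        Fintype.card_subtype, H.card_fibers_eq]
  have hnone : ∀ x, w (π x) = none ↔ w x = none := fun x => by
    have := congrArg Prod.fst (hπ x)
    simpa only [valueColor, positionColor, decide_eq_decide] using this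
  have hopen : ∀ x, (w (π x)).opens = (w x).closes := fun x => congrArg Prod.snd (hπ x)
  have hfix : π b = b := (hb _).1 ((hnone b).2 ((hb b).2 rfl))
  have hrank := card_filter_lt_fiber hπ mπ
  have hc : ∀ x, (w x).closes = true ↔ π x < x := by
    intro x
    constructor
    -- Positive height means more openings than closings before `x`. As `π x` has equal rank among
    -- openings, it lies before `x`.
    · intro hx
      by_contra hlt
      have hnn : w x ≠ none := fun h => by
        rw [h] at hx
        simp [PathLetter.closes] at hx
      have hr := hrank x
      have hcol : positionColor w x = (false, true) := by simp [positionColor, hx, hnn]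
      have e1 : #{j | j.1 < x.1 ∧ positionColor w j = positionColor w x} =
          #{j | j.1 < x.1 ∧ (w j).closes = true} := by
        rw [hcol]
        congr 1
        ext j
        cases h : w j <;> simp [positionColor, h, PathLetter.closes]
      have e2 : #{j | j.1 < (π x).1 ∧ valueColor w j = positionColor w x} =
          #{j | j.1 < (π x).1 ∧ (w j).opens = true} := by
        rw [hcol]
        congr 1
        ext j
        cases h : w j <;> simp [valueColor, h, PathLetter.opens]
      have hh := H.closes x hx
      rw [pathHeight_eq_card_sub_card] at hh
      have := card_filter_lt_le_card_filter_lt (q := fun j => (w j).opens = true) (not_lt.1 hlt)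
      omega
    -- If an unmarked non-closing `x` had `π x < x`, equal ranks would give more non-openings than
    -- non-closings before `x`, a negative height.
    · intro hlt
      by_contra hx
      have hxb : w x ≠ none := fun e => by
        rw [(hb x).1 e, hfix] at hlt
        exact lt_irrefl _ hlt
      have hr := hrank x
      have hcol : positionColor w x = (false, false) := by
        simpa [positionColor, hxb] using hx
      have hq : valueColor w (π x) = (false, false) := by rw [hπ, hcol]
      rw [hcol] at hr
      have h1 := card_filter_lt_lt_card_filter_lt (q := fun j => valueColor w j = (false, false))
        hq hlt
      have s1 : _ + #{i | i.1 < x.1 ∧ valueColor w i = (false, false)} + _ = _ :=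
        card_filter_lt_split w PathLetter.opens rfl x.1
      have s2 : _ + #{i | i.1 < x.1 ∧ positionColor w i = (false, false)} + _ = _ :=
        card_filter_lt_split w PathLetter.closes rfl x.1
      have hh := H.nonneg x.1
      rw [pathHeight_eq_card_sub_card] at hh
      omega
  have ho : ∀ x, (w x).opens = true ↔ x < π.symm x := fun x => by
    have h1 := hopen (π.symm x)
    have h2 := hc (π.symm x)
    rw [Equiv.apply_symm_apply] at h1 h2
    rw [h1, h2]
  refine ⟨π, b, ⟨hfix, ?_, fun x y hx hy hxy => ?_, fun x y hx hy hxb hyb hxy => ?_⟩, ?_⟩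
  · have h1 := H.mark b ((hb b).2 rfl)
    rw [pathHeight_eq_card_crossing ho hc] at h1
    omega
  · refine mπ x y ?_ hxy
    have hxb : ¬ w x = none := fun e => by
      rw [(hb x).1 e, hfix] at hx
      exact lt_irrefl _ hx
    have hyb : ¬ w y = none := fun e => by
      rw [(hb y).1 e, hfix] at hy
      exact lt_irrefl _ hy
    simp [positionColor, (hc x).2 hx, (hc y).2 hy, hxb, hyb]
  · refine mπ x y ?_ hxy
    have h1 : (w x).closes = false := by
      rw [← Bool.not_eq_true, hc]
      exact not_lt.2 hx
    have h2 : (w y).closes = false := by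
      rw [← Bool.not_eq_true, hc]
      exact not_lt.2 hy
    simp [positionColor, h1, h2, hb, hxb, hyb]
  · funext i
    by_cases hi : i = b
    · rw [(hb i).2 hi, centerWord_eq_none, hi]
    · obtain ⟨a, ha⟩ := Option.ne_none_iff_exists'.1 fun e => hi ((hb i).1 e)
      have h1 := ho i
      have h2 := hc i
      rw [ha] at h1 h2 ⊢
      rw [centerWord, if_neg hi]
      congr 1
      refine Prod.ext ?_ ?_
      · rw [Bool.eq_iff_iff, decide_eq_true_iff, ← h1]
        rfl
      · rw [Bool.eq_iff_iff, decide_eq_true_iff, ← h2]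
        rfl

/-! ### The enumeration -/

/-- The pairs of a permutation and its center project injectively to permutations and to words, so
one count serves both families. -/
theorem ncard_hasOccurrences_eq_card_markedPaths {N : ℕ} (Q : Equiv.Perm (Fin N) → Prop)
    (R : (Fin N → PathLetter) → Prop)
    (hQR : ∀ π b, HasCenter π b → (Q π ↔ R (centerWord π b))) :
    {π | Q π ∧ HasOccurrences pattern321 1 π}.ncard =
      Nat.card {w : Fin N → PathLetter // IsMarkedPath 0 1 w ∧ R w} := by
  have e1 : {π | Q π ∧ HasOccurrences pattern321 1 π} =
      Prod.fst '' {y : Equiv.Perm (Fin N) × Fin N | Q y.1 ∧ HasCenter y.1 y.2} := by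
    ext π
    simp [hasOccurrences_iff_exists_hasCenter]
  have e2 : {w : Fin N → PathLetter | IsMarkedPath 0 1 w ∧ R w} =
      (fun y => centerWord y.1 y.2) ''
        {y : Equiv.Perm (Fin N) × Fin N | Q y.1 ∧ HasCenter y.1 y.2} := by
    ext w
    constructor
    · rintro ⟨hw, hR⟩
      obtain ⟨π, b, H, rfl⟩ := hw.exists_hasCenter
      exact ⟨(π, b), ⟨(hQR π b H).2 hR, H⟩, rfl⟩
    · rintro ⟨⟨π, b⟩, ⟨hQ, H⟩, rfl⟩
      exact ⟨H.isMarkedPath, (hQR π b H).1 hQ⟩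
  have e3 : Nat.card {w : Fin N → PathLetter // IsMarkedPath 0 1 w ∧ R w} =
      {w : Fin N → PathLetter | IsMarkedPath 0 1 w ∧ R w}.ncard := rfl
  rw [e3, e1, e2, Set.InjOn.ncard_image, Set.InjOn.ncard_image]
  · rintro ⟨π, b⟩ ⟨-, H⟩ ⟨σ, c⟩ ⟨-, H'⟩ h
    obtain rfl : π = σ := H.eq_of_centerWord_eq H' h
    exact Prod.ext rfl (H.unique H')
  · rintro ⟨π, b⟩ ⟨-, H⟩ ⟨σ, c⟩ ⟨-, H'⟩ h
    obtain rfl : π = σ := h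
    exact Prod.ext rfl (H.unique H')

theorem ncard_permsWithOccurrences_pattern321 (N : ℕ) :
    (permsWithOccurrences N pattern321 1).ncard = pathCount N 0 1 := by
  have := ncard_hasOccurrences_eq_card_markedPaths (N := N) (fun _ => True) (fun _ => True)
    (fun _ _ _ => Iff.rfl)
  simp only [true_and, and_true] at this
  exact this

theorem HasCenter.isDumont4_iff {n : ℕ} {π : Equiv.Perm (Fin (2 * n))} {b : Fin (2 * n)}
    (H : HasCenter π b) : IsDumont4 n π ↔ IsEvenWord (centerWord π b) := by
  constructor
  -- Indices start at zero, so an even index is an odd position.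
  · intro h i hi
    by_cases hb : i = b
    · exact Or.inl (centerWord_eq_none.2 hb)
    · right
      have h1 : ¬ π i < i := fun hlt => by
        have := (h i hlt).1
        rw [Nat.even_add_one] at this
        exact this hi
      have h2 : ¬ i < π.symm i := fun hlt => by
        have := (h (π.symm i) (by rwa [Equiv.apply_symm_apply])).2
        rw [Equiv.apply_symm_apply, Nat.even_add_one] at this
        exact this hi
      simp [centerWord, hb, h1, h2]
  · intro h i hlt
    rw [Nat.even_add_one, Nat.even_add_one]
    constructor
    · intro he
      have h1 := (H.closes_centerWord i).2 hlt
      rcases h i he with h2 | h2 <;> simp [h2, PathLetter.closes] at h1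
    · intro he
      have h1 := (H.opens_centerWord (π i)).2 (by rwa [Equiv.symm_apply_apply])
      rcases h (π i) he with h2 | h2 <;> simp [h2, PathLetter.opens] at h1

theorem ncard_dumont4WithOccurrences_pattern321 (n : ℕ) :
    (dumont4WithOccurrences n pattern321 1).ncard = pathCount n 0 1 + pathCount (n + 1) 0 1 :=
  (ncard_hasOccurrences_eq_card_markedPaths (IsDumont4 n) IsEvenWord
    fun _ _ H => H.isDumont4_iff).trans (evenPathCount_marked n 0)

theorem mainTheorem1 :
    (∀ n : ℕ, 1 ≤ n →
      (dumont4WithOccurrences n pattern321 1).ncard =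
          (permsWithOccurrences n pattern321 1).ncard +
            (permsWithOccurrences (n + 1) pattern321 1).ncard ∧
      ((dumont4WithOccurrences n pattern321 1).ncard : ℚ) =
          3 / (n : ℚ) * (intChoose (2 * n) ((n : ℤ) - 3) : ℚ) +
            3 / ((n : ℚ) + 1) * (intChoose (2 * n + 2) ((n : ℤ) - 2) : ℚ) ∧
      ((dumont4WithOccurrences n pattern321 1).ncard : ℤ) =
          (catalan (n + 3) : ℤ) - 3 * (catalan (n + 2) : ℤ) - (catalan (n + 1) : ℤ) +
            3 * (catalan n : ℤ)) ∧
    (PowerSeries.mk fun n : ℕ => (dumont4WithOccurrences n pattern321 1).ncard) =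
      (PowerSeries.X ^ 2 + PowerSeries.X ^ 3) * PowerSeries.catalanSeries ^ 6 := by
  simp only [ncard_dumont4WithOccurrences_pattern321, ncard_permsWithOccurrences_pattern321]
  refine ⟨fun n hn => ⟨trivial, ?_, ?_⟩, ?_⟩
  · have h1 := pathCount_marked_eq_catalan hn
    have h2 := pathCount_marked_eq_catalan (Nat.le_add_left 1 n)
    have h3 := three_div_mul_intChoose hn
    have h4 := three_div_mul_intChoose (Nat.le_add_left 1 n)
    have e : ((n + 1 : ℕ) : ℤ) - 3 = n - 2 := by push_cast; ring
    rw [e, show 2 * (n + 1) = 2 * n + 2 by ring, Nat.cast_add, Nat.cast_one] at h4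
    rw [h3, h4]
    have h1' := congrArg (Int.cast : ℤ → ℚ) h1
    have h2' := congrArg (Int.cast : ℤ → ℚ) h2
    push_cast at h1' h2' ⊢
    rw [h1', h2']
  · rw [Nat.cast_add, pathCount_marked_eq_catalan hn,
      pathCount_marked_eq_catalan (Nat.le_add_left 1 n)]
    ring
  · refine PowerSeries.map_injective (Nat.castRingHom ℤ) Nat.cast_injective ?_
    have : PowerSeries.map (Nat.castRingHom ℤ) ((PowerSeries.X ^ 2 + PowerSeries.X ^ 3) *
        PowerSeries.catalanSeries ^ 6) =
        PowerSeries.X ^ 2 * catalanSeriesInt ^ 6 + PowerSeries.X ^ 3 * catalanSeriesInt ^ 6 := by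
      simp only [map_add, map_mul, map_pow, PowerSeries.map_X, catalanSeriesInt]
      ring
    rw [this]
    ext n
    simp only [PowerSeries.coeff_map, PowerSeries.coeff_mk, map_add, eq_natCast,
      coeff_pathCount_marked]
    -- The shift from `n` to `n + 1` removes one factor `X` from X^3C^6.
    rw [add_comm, pow_succ' PowerSeries.X 2, mul_assoc, PowerSeries.coeff_succ_X_mul]
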